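/- Let $N, D \ge 1$ be integers. For $X \in \mathbb{C}^{N\times D}$ write $x^{(1)},\dots,x^{(N)} \in \mathbb{C}^D$ for its rows, and let $\Pi(N)$ be the set of $N\times N$ permutation matrices. For $x \in \mathbb{C}^D$ put $\widetilde{x} = [\Re(x)^\top\ \Im(x)^\top]^\top \in \mathbb{R}^{2D}$, and for $z\in\mathbb{R}$ put $\psi_N(z) = [z\ z^2\ \cdots\ z^N]^\top \in \mathbb{R}^N$. A map $\phi:\mathbb{C}^D\to\mathbb{R}^L$ is called - *of LP form* if $L = KN$ for some integer $K \ge 0$ and there are $w_1,\dots,w_K\in\mathbb{R}^{2D}$ with $\phi(x) = [\psi_N(w_1^\top\widetilde{x})^\top\ \cdots\ \psi_N(w_K^\top\widetilde{x})^\top]^\top$ for all $x \in \mathbb{C}^D$; - *of LE form* if there are $v_1,\dots,v_L\in\mathbb{R}^{2D}$ with $\phi(x) = [\exp(v_1^\top\widetilde{x})\ \cdots\ \exp(v_L^\top\widetilde{x})]^\top$ for all $x \in \mathbb{C}^D$. **(Invariant functions.)** Let $f:\mathbb{C}^{N\times D}\to\mathbb{C}$ be continuous and permutation-invariant, i.e.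 $f(PX) = f(X)$ for all $P\in\Pi(N)$ and all $X$. Then there are an integer $L$ and continuous maps $\phi:\mathbb{C}^D\to\mathbb{R}^L$ and $\rho:\mathbb{R}^L\to\mathbb{C}$ such that $$f(X) = \rho\Big(\sum_{i=1}^N \phi(x^{(i)})\Big)\quad\text{for all } X\in\mathbb{C}^{N\times D},$$ where one can take $\phi$ of LP form with some $L \in [2N(D+1),\, 4N^5D^2]$, and one can also take $\phi$ of LE form with some $L\in[2ND,\, 4N^4D^2]$. **(Equivariant functions.)** Let $f:\mathbb{C}^{N\times D}\to\mathbb{C}^N$ be continuous and permutation-equivariant, i.e. $f(PX) = P f(X)$ for all $P\in\Pi(N)$ and all $X$. Then there are an integer $L$ and continuous maps $\phi:\mathbb{C}^D\to\mathbb{R}^L$ and $\rho:\mathbb{C}^D\times\mathbb{R}^L\to\mathbb{C}$ such that $$f(X)_j = \rho\Big(x^{(j)},\, \sum_{i=1}^N \phi(x^{(i)})\Big)\quad\text{for all } X\in\mathbb{C}^{N\times D}\text{ and } j\in\{1,\dots,N\},$$ where one can take $\phi$ of LP form with some $L \in [2N(D+1),\, 4N^5D^2]$, and one can also take $\phi$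 of LE form with some $L\in[2ND,\, 4N^4D^2]$. -/

import Mathlib

/-- `f (P X) = f X` for every permutation matrix `P`; the rows of `X` are the set elements. -/
def IsPermInvariant {N D : ℕ} (f : Matrix (Fin N) (Fin D) ℂ → ℂ) : Prop :=
  ∀ (σ : Equiv.Perm (Fin N)) (X : Matrix (Fin N) (Fin D) ℂ), f (σ.permMatrix ℂ * X) = f X

/-- `f (P X) = P f(X)` for every permutation matrix `P`. -/
def IsPermEquivariant {N D : ℕ} (f : Matrix (Fin N) (Fin D) ℂ → (Fin N → ℂ)) : Prop :=
  ∀ (σ : Equiv.Perm (Fin N)) (X : Matrix (Fin N) (Fin D) ℂ),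
    f (σ.permMatrix ℂ * X) = Matrix.mulVec (σ.permMatrix ℂ) (f X)

/-- The real feature vector `[Re x, Im x]` in `ℝ^{2D}` of a complex feature vector `x` in `ℂ^D`. -/
def reIm {D : ℕ} (x : Fin D → ℂ) : Fin D ⊕ Fin D → ℝ :=
  Sum.elim (fun d => (x d).re) (fun d => (x d).im)

/-- The power mapping `z ↦ [z, z^2, …, z^N]`. -/
def powerMapping (N : ℕ) (z : ℝ) : Fin N → ℝ := fun j => z ^ ((j : ℕ) + 1)

/-- Linear layer followed by the power mapping: the concatenation of the `K` blocks
`powerMapping N (wₖᵀ x)`, each of length `N`. -/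
def lpLayer (N : ℕ) {ι : Type*} [Fintype ι] {K : ℕ} (w : Fin K → ι → ℝ) (x : ι → ℝ) :
    Fin (K * N) → ℝ :=
  fun l => powerMapping N (w (finProdFinEquiv.symm l).1 ⬝ᵥ x) (finProdFinEquiv.symm l).2

/-- Linear layer followed by the entrywise exponential. -/
noncomputable def leLayer {ι : Type*} [Fintype ι] {L : ℕ} (v : Fin L → ι → ℝ) (x : ι → ℝ) :
    Fin L → ℝ :=
  fun l => Real.exp (v l ⬝ᵥ x)

/-- `φ : ℂ^D → ℝ^L` is an LP layer, with powers up to `N`, applied to the real and imaginary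
parts; in particular `L = K * N`. -/
def IsLP (N : ℕ) {D L : ℕ} (φ : (Fin D → ℂ) → (Fin L → ℝ)) : Prop :=
  ∃ (K : ℕ) (hK : L = K * N) (w : Fin K → (Fin D ⊕ Fin D) → ℝ),
    ∀ (x : Fin D → ℂ) (l : Fin L), φ x l = lpLayer N w (reIm x) (Fin.cast hK l)

/-- `φ : ℂ^D → ℝ^L` is an LE layer applied to the real and imaginary parts. -/
def IsLE {D L : ℕ} (φ : (Fin D → ℂ) → (Fin L → ℝ)) : Prop :=
  ∃ v : Fin L → (Fin D ⊕ Fin D) → ℝ, ∀ x : Fin D → ℂ, φ x = leLayer v (reIm x)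

/-! The pooled map sending `X` to the sum of `φ` over its rows separates permutation orbits and is
proper. Hence an invariant `f` descends to its closed image, continuously because a proper map is a
quotient onto its image, and Tietze extends it to `ρ`.

Separation: by Newton's identities the features give, for each direction `w k`, the multiset of
projections of the rows. With more than `N(2D-1)` directions in general position in dimension `2D`,
a pigeonhole argument recovers the multiset of rows. Properness: bounded features force bounded
projections, and these determine the rows linearly and injectively.

The equivariant case applies the same factorization to one output coordinate, with its row kept
beside the pooled features. -/

/-! ### Newton's identities and multisets of reals -/

/-- The first `N` power sums of `N` elements determine their elementary symmetric polynomials. -/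
theorem esymm_eq_of_powerSums_eq {N : ℕ} {a b : Fin N → ℝ}
    (h : ∀ s : Fin N, ∑ i, a i ^ ((s : ℕ) + 1) = ∑ i, b i ^ ((s : ℕ) + 1)) (k : ℕ) (hk : k ≤ N) :
    MvPolynomial.aeval a (MvPolynomial.esymm (Fin N) ℝ k) =
      MvPolynomial.aeval b (MvPolynomial.esymm (Fin N) ℝ k) := by
  induction k using Nat.strong_induction_on with
  | _ k ih =>
    rcases Nat.eq_zero_or_pos k with rfl | hpos
    · simp
    have ha := congrArg (MvPolynomial.aeval a) (MvPolynomial.mul_esymm_eq_sum (Fin N) ℝ k)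
    have hb := congrArg (MvPolynomial.aeval b) (MvPolynomial.mul_esymm_eq_sum (Fin N) ℝ k)
    simp only [map_mul, map_natCast, map_pow, map_neg, map_one, map_sum] at ha hb
    have hk0 : (k : ℝ) ≠ 0 := by exact_mod_cast hpos.ne'
    refine mul_left_cancel₀ hk0 ?_
    rw [ha, hb]
    congr 1
    refine Finset.sum_congr rfl fun p hp => ?_
    obtain ⟨hp1, hp⟩ := Finset.mem_filter.1 hp
    rw [Finset.HasAntidiagonal.mem_antidiagonal] at hp1
    -- The filter `p.1 < k` makes `p.2` positive, so its power sum is among those in `h`, at index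
    -- `p.2 - 1`.
    have hp2 : p.2 - 1 < N := by omega
    have hps := h ⟨p.2 - 1, hp2⟩
    have hp21 : p.2 - 1 + 1 = p.2 := by omega
    simp only [hp21] at hps
    rw [ih p.1 hp (by omega)]
    congr 1
    simpa [MvPolynomial.psum] using hps

/-- The first `N` power sums of `N` real numbers determine them up to order. -/
theorem map_eq_of_powerSums_eq {N : ℕ} {a b : Fin N → ℝ}
    (h : ∀ s : Fin N, ∑ i, a i ^ ((s : ℕ) + 1) = ∑ i, b i ^ ((s : ℕ) + 1)) :
    Finset.univ.val.map a = Finset.univ.val.map b := by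
  have key : ((Finset.univ.val.map a).map fun t => Polynomial.X - Polynomial.C t).prod =
      ((Finset.univ.val.map b).map fun t => Polynomial.X - Polynomial.C t).prod := by
    rw [Multiset.prod_X_sub_X_eq_sum_esymm, Multiset.prod_X_sub_X_eq_sum_esymm]
    simp only [Multiset.card_map, Finset.card_val, Finset.card_univ, Fintype.card_fin]
    refine Finset.sum_congr rfl fun j hj => ?_
    have := esymm_eq_of_powerSums_eq h j (by simpa [Nat.lt_succ_iff] using hj)
    rw [MvPolynomial.aeval_esymm_eq_multiset_esymm,
      MvPolynomial.aeval_esymm_eq_multiset_esymm] at this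
    rw [this]
  have := congrArg Polynomial.roots key
  rwa [Polynomial.roots_multiset_prod_X_sub_C, Polynomial.roots_multiset_prod_X_sub_C] at this

/-- Families with equal multisets of values differ by a permutation. -/
theorem exists_perm_of_map_eq {N : ℕ} {α : Type*} {a b : Fin N → α}
    (h : Finset.univ.val.map a = Finset.univ.val.map b) :
    ∃ σ : Equiv.Perm (Fin N), b = a ∘ σ := by
  classical
  -- Corresponding fibres have equal size; gluing bijections between them gives the permutation.
  have hc : ∀ c, Fintype.card {i // b i = c} = Fintype.card {i // a i = c} := by
    intro c
    have := congrArg (Multiset.count c) h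
    rw [Multiset.count_map, Multiset.count_map] at this
    simp only [Fintype.card_subtype, Finset.card_def, Finset.filter_val]
    simpa [eq_comm] using this.symm
  let e : ∀ c, {i // b i = c} ≃ {i // a i = c} := fun c => Fintype.equivOfCardEq (hc c)
  refine ⟨(Equiv.sigmaFiberEquiv b).symm.trans
    ((Equiv.sigmaCongrRight e).trans (Equiv.sigmaFiberEquiv a)), ?_⟩
  funext i
  exact (e (b i) ⟨i, rfl⟩).2.symm

/-! ### Directions in general position -/

/-- A family of vectors is in general position for hyperplanes if a nonzero vector is orthogonal
to fewer members of the family than the dimension. -/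
def InGeneralPosition {ι κ : Type*} [Fintype ι] (w : κ → ι → ℝ) : Prop :=
  ∀ u : ι → ℝ, u ≠ 0 → ∀ s : Finset κ, (∀ k ∈ s, w k ⬝ᵥ u = 0) → s.card < Fintype.card ι

/-- Points on the moment curve are in general position. -/
theorem exists_inGeneralPosition (ι : Type*) [Fintype ι] (K : ℕ) :
    ∃ w : Fin K → ι → ℝ, InGeneralPosition w := by
  let e := Fintype.equivFin ι
  refine ⟨fun k i => ((k : ℕ) : ℝ) ^ (e i : ℕ), fun u hu s hs => ?_⟩
  by_contra! hcard
  obtain ⟨t, hts, htc⟩ := Finset.exists_subset_card_eq hcard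
  let g := t.equivFinOfCardEq htc
  refine hu ?_
  -- As many chosen points as the dimension form a square Vandermonde system with distinct nodes.
  have hz : (fun i => u (e.symm i)) = 0 := by
    refine Matrix.eq_zero_of_forall_index_sum_pow_mul_eq_zero
      (f := fun j => (((g.symm j : Fin K) : ℕ) : ℝ)) ?_ fun j => ?_
    · intro i j hij
      apply g.symm.injective
      apply Subtype.ext
      apply Fin.ext
      exact Nat.cast_injective hij
    · have := hs _ (hts (g.symm j).2)
      rw [dotProduct, ← e.symm.sum_comp] at this
      simpa using this
  funext i
  simpa using congrFun hz (e i)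

theorem eq_zero_of_forall_dotProduct_eq_zero {ι : Type*} [Fintype ι] {K : ℕ} {w : Fin K → ι → ℝ}
    (hw : InGeneralPosition w) (hK : Fintype.card ι ≤ K) {u : ι → ℝ}
    (hu : ∀ k, w k ⬝ᵥ u = 0) : u = 0 := by
  by_contra h
  have := hw u h Finset.univ fun k _ => hu k
  simp at this
  omega

/-- Enough projections along directions in general position determine a finite multiset. -/
theorem multiset_eq_of_projections_eq {ι : Type*} [Fintype ι] {N K : ℕ} {w : Fin K → ι → ℝ}
    (hw : InGeneralPosition w) (hK : N * (Fintype.card ι - 1) < K) {A B : Multiset (ι → ℝ)}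
    (hA : A.card = N) (hB : B.card = N)
    (h : ∀ k, A.map (w k ⬝ᵥ ·) = B.map (w k ⬝ᵥ ·)) : A = B := by
  classical
  have hsub : A ≤ B := by
    rw [← tsub_eq_zero_iff_le, Multiset.eq_zero_iff_forall_notMem]
    intro x hx
    have hd : ∀ k, (A - B).map (w k ⬝ᵥ ·) = (B - A).map (w k ⬝ᵥ ·) := by
      intro k
      have h1 : A - B + A ∩ B = A := Multiset.sub_add_inter A B
      have h2 : B - A + A ∩ B = B := by rw [Multiset.inter_comm]; exact Multiset.sub_add_inter B A
      have h3 := h k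
      refine add_right_cancel (b := (A ∩ B).map (w k ⬝ᵥ ·)) ?_
      rw [← Multiset.map_add, ← Multiset.map_add, h1, h2, h3]
    have hy : ∀ k, ∃ y ∈ B - A, w k ⬝ᵥ y = w k ⬝ᵥ x := by
      intro k
      have : w k ⬝ᵥ x ∈ (A - B).map (w k ⬝ᵥ ·) := Multiset.mem_map_of_mem _ hx
      rw [hd k] at this
      simpa using this
    choose y hyB hyx using hy
    -- Each `z` in `B - A` differs from `x`, so general position lets it share the projection of `x`
    -- along at most `card ι - 1` directions.
    have hcount : (Finset.univ : Finset (Fin K)).card ≤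
        (Fintype.card ι - 1) * (B - A).toFinset.card := by
      refine Finset.card_le_mul_card_image_of_maps_to (f := y)
        (fun k _ => by simpa using hyB k) _ fun z hz => ?_
      have hzx : z - x ≠ 0 := by
        intro h0
        rw [sub_eq_zero] at h0
        subst h0
        rw [Multiset.mem_toFinset] at hz
        have h1 := Multiset.count_pos.2 hz
        have h2 := Multiset.count_pos.2 hx
        rw [Multiset.count_sub] at h1 h2
        omega
      refine Nat.le_sub_one_of_lt (hw (z - x) hzx _ fun k hk => ?_)
      rw [Finset.mem_filter] at hk
      rw [dotProduct_sub, ← hk.2, hyx, sub_self]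
    have hBA : (B - A).toFinset.card ≤ N :=
      (Multiset.toFinset_card_le _).trans (hB ▸ Multiset.card_le_card tsub_le_self)
    have := hcount.trans (Nat.mul_le_mul_left _ hBA)
    rw [Finset.card_univ, Fintype.card_fin, mul_comm] at this
    omega
  exact Multiset.eq_of_le_of_card_le hsub (by omega)

/-! ### Factoring through a proper map -/

/-- A continuous function that factors through a proper map to a normal space extends to the
whole target. -/
theorem exists_continuous_factor {X Y : Type*} [TopologicalSpace X] [TopologicalSpace Y]
    [NormalSpace Y] {g : X → Y} (hg : IsProperMap g) {f : X → ℂ} (hf : Continuous f)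
    (hfg : ∀ a b, g a = g b → f a = f b) :
    ∃ ρ : Y → ℂ, Continuous ρ ∧ ∀ x, f x = ρ (g x) := by
  have hcl : IsClosedMap (Set.rangeFactorization g) := fun s hs => by
    have := (hg.isClosedMap s hs).preimage (continuous_subtype_val (p := (· ∈ Set.range g)))
    convert this using 1
    ext ⟨y, hy⟩
    simp [Set.rangeFactorization, Subtype.ext_iff]
  have hq : Topology.IsQuotientMap (Set.rangeFactorization g) :=
    hcl.isQuotientMap (hg.continuous.subtype_mk _) Set.rangeFactorization_surjective
  let f' : Set.range g → ℂ := fun y => f y.2.choose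
  have hf' : ∀ x, f' (Set.rangeFactorization g x) = f x := fun x =>
    hfg _ _ (Set.rangeFactorization g x).2.choose_spec
  have hf'c : Continuous f' := hq.continuous_iff.2 (by rwa [show f' ∘ _ = f from funext hf'])
  obtain ⟨ρ, hρ⟩ := ContinuousMap.exists_restrict_eq hg.isClosedMap.isClosed_range ⟨f', hf'c⟩
  refine ⟨ρ, ρ.continuous, fun x => ?_⟩
  rw [← hf' x]
  exact (congrArg (fun F : C(Set.range g, ℂ) => F (Set.rangeFactorization g x)) hρ).symm

/-! ### Separation and properness of pooled features -/

/-- The pooled features determine the projections along `w`, and control their size. -/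
structure PooledFeatures (N : ℕ) {D K L : ℕ} (w : Fin K → Fin D ⊕ Fin D → ℝ)
    (φ : (Fin D → ℂ) → (Fin L → ℝ)) : Prop where
  continuous : Continuous φ
  bound : ∀ C : ℝ, ∃ C' : ℝ, ∀ X : Fin N → Fin D → ℂ, ‖∑ i, φ (X i)‖ ≤ C →
    ∀ i k, |w k ⬝ᵥ reIm (X i)| ≤ C'
  determines : ∀ X Y : Fin N → Fin D → ℂ, ∑ i, φ (X i) = ∑ i, φ (Y i) → ∀ k,
    Finset.univ.val.map (fun i => w k ⬝ᵥ reIm (X i)) =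
      Finset.univ.val.map (fun i => w k ⬝ᵥ reIm (Y i))

theorem reIm_injective {D : ℕ} : Function.Injective (reIm (D := D)) := fun x y h => by
  funext d
  exact Complex.ext (congrFun h (Sum.inl d)) (congrFun h (Sum.inr d))

theorem continuous_reIm {D : ℕ} : Continuous (reIm (D := D)) := by
  refine continuous_pi fun i => ?_
  rcases i with d | d
  · exact Complex.continuous_re.comp (continuous_apply d)
  · exact Complex.continuous_im.comp (continuous_apply d)

/-- All projections of all rows, as a real linear map. -/
def rowProjections (N : ℕ) {D K : ℕ} (w : Fin K → Fin D ⊕ Fin D → ℝ) :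
    (Fin N → Fin D → ℂ) →ₗ[ℝ] (Fin N → Fin K → ℝ) where
  toFun X i k := w k ⬝ᵥ reIm (X i)
  map_add' X Y := by
    funext i k
    have : reIm ((X + Y) i) = reIm (X i) + reIm (Y i) := by
      funext d; rcases d with d | d <;> simp [reIm]
    exact (congrArg (w k ⬝ᵥ ·) this).trans (dotProduct_add _ _ _)
  map_smul' c X := by
    funext i k
    have : reIm ((c • X) i) = c • reIm (X i) := by
      funext d; rcases d with d | d <;> simp [reIm]
    exact (congrArg (w k ⬝ᵥ ·) this).trans (dotProduct_smul _ _ _)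

theorem permMatrix_mul_eq_comp {N D : ℕ} (σ : Equiv.Perm (Fin N)) (X : Matrix (Fin N) (Fin D) ℂ) :
    σ.permMatrix ℂ * X = X ∘ σ :=
  PEquiv.toMatrix_toPEquiv_mul σ X

namespace PooledFeatures

variable {N D K L : ℕ} {w : Fin K → Fin D ⊕ Fin D → ℝ} {φ : (Fin D → ℂ) → (Fin L → ℝ)}

theorem exists_perm (h : PooledFeatures N w φ) (hw : InGeneralPosition w)
    (hK : N * (2 * D - 1) < K) {X Y : Fin N → Fin D → ℂ}
    (hXY : ∑ i, φ (X i) = ∑ i, φ (Y i)) : ∃ σ : Equiv.Perm (Fin N), Y = X ∘ σ := by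
  refine exists_perm_of_map_eq ?_
  refine Multiset.map_injective reIm_injective ?_
  refine multiset_eq_of_projections_eq (N := N) hw ?_ (by simp) (by simp) fun k => ?_
  · simpa [← two_mul] using hK
  · simpa [Multiset.map_map, Function.comp_def] using h.determines X Y hXY k

theorem isProperMap (h : PooledFeatures N w φ) (hw : InGeneralPosition w) (hK : 2 * D ≤ K) :
    IsProperMap (fun X : Fin N → Fin D → ℂ => ∑ i, φ (X i)) := by
  have hcont : Continuous (fun X : Fin N → Fin D → ℂ => ∑ i, φ (X i)) :=
    continuous_finsetSum _ fun i _ => h.continuous.comp (continuous_apply i)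
  rw [isProperMap_iff_isCompact_preimage]
  refine ⟨hcont, fun Q hQ => ?_⟩
  obtain ⟨C, hC⟩ := hQ.isBounded.exists_norm_le
  obtain ⟨C', hC'⟩ := h.bound C
  have hemb : Topology.IsClosedEmbedding (rowProjections N w) := by
    refine LinearMap.isClosedEmbedding_of_injective (LinearMap.ker_eq_bot.2 ?_)
    intro X Y hXY
    funext i
    apply reIm_injective
    rw [← sub_eq_zero]
    refine eq_zero_of_forall_dotProduct_eq_zero hw (by simpa [← two_mul] using hK) fun k => ?_
    rw [dotProduct_sub, sub_eq_zero]
    exact congrFun (congrFun hXY i) k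
  have hball : IsCompact {Z : Fin N → Fin K → ℝ | ∀ i k, Z i k ∈ Set.Icc (-C') C'} := by
    have := isCompact_univ_pi fun _ : Fin N =>
      isCompact_univ_pi fun _ : Fin K => isCompact_Icc (a := -C') (b := C')
    convert this using 1
    ext Z
    simp only [Set.mem_ofPred_eq, Set.mem_pi, Set.mem_univ, true_imp_iff]
  refine (hemb.isCompact_preimage hball).of_isClosed_subset (hQ.isClosed.preimage hcont) ?_
  intro X hX i k
  exact abs_le.1 (hC' X (hC _ hX) i k)

theorem exists_invariant (h : PooledFeatures N w φ) (hw : InGeneralPosition w)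
    (hK : N * (2 * D - 1) < K) (hK' : 2 * D ≤ K) {f : Matrix (Fin N) (Fin D) ℂ → ℂ}
    (hf : Continuous f) (hinv : IsPermInvariant f) :
    ∃ ρ : (Fin L → ℝ) → ℂ, Continuous ρ ∧
      ∀ X : Matrix (Fin N) (Fin D) ℂ, f X = ρ (∑ i, φ (X i)) := by
  refine exists_continuous_factor (h.isProperMap hw hK') hf fun X Y hXY => ?_
  obtain ⟨σ, rfl⟩ := h.exists_perm hw hK hXY
  exact ((congrArg f (permMatrix_mul_eq_comp σ X)).symm.trans (hinv σ X)).symm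

theorem exists_equivariant (h : PooledFeatures N w φ) (hw : InGeneralPosition w)
    (hN : 1 ≤ N) (hK : N * (2 * D - 1) < K) (hK' : 2 * D ≤ K)
    {f : Matrix (Fin N) (Fin D) ℂ → (Fin N → ℂ)}
    (hf : Continuous f) (heq : IsPermEquivariant f) :
    ∃ ρ : (Fin D → ℂ) × (Fin L → ℝ) → ℂ, Continuous ρ ∧
      ∀ (X : Matrix (Fin N) (Fin D) ℂ) (j : Fin N), f X j = ρ (X j, ∑ i, φ (X i)) := by
  have hperm : ∀ (σ : Equiv.Perm (Fin N)) (X : Fin N → Fin D → ℂ) (j : Fin N),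
      f (X ∘ σ) j = f X (σ j) := by
    intro σ X j
    have h1 := (heq σ X).trans (Matrix.permMatrix_mulVec (σ := σ))
    exact congrFun ((congrArg f (permMatrix_mul_eq_comp σ X)).symm.trans h1) j
  let z : Fin N := ⟨0, hN⟩
  have hS := h.isProperMap hw hK'
  -- Adding a coordinate preserves properness, since the second component is already proper.
  have hg : IsProperMap (fun X : Fin N → Fin D → ℂ => (X z, ∑ i, φ (X i))) :=
    isProperMap_of_comp_of_t2 ((continuous_apply z).prodMk hS.continuous) continuous_snd hS
  have hfz : Continuous fun X : Fin N → Fin D → ℂ => f X z := (continuous_apply z).comp hf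
  obtain ⟨ρ, hρ, hfac⟩ := exists_continuous_factor hg hfz fun X Y hXY => by
    obtain ⟨h1, h2⟩ := Prod.mk.inj hXY
    obtain ⟨σ, rfl⟩ := h.exists_perm hw hK h2
    -- Rows `z` and `σ z` coincide, so swapping them fixes `X` and equivariance equates the two
    -- outputs.
    have hswap : X ∘ Equiv.swap z (σ z) = X := by
      funext i
      by_cases hi : i = z
      · subst hi; simpa using h1.symm
      by_cases hi' : i = σ z
      · subst hi'; simpa using h1
      · simp [Equiv.swap_apply_of_ne_of_ne hi hi']
    rw [hperm]
    have := hperm (Equiv.swap z (σ z)) X z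
    rwa [hswap, Equiv.swap_apply_left] at this
  refine ⟨ρ, hρ, fun X j => ?_⟩
  have h1 := hfac (X ∘ Equiv.swap z j)
  have h2 := hperm (Equiv.swap z j) X z
  rw [Equiv.swap_apply_left] at h2
  rw [← h2, h1]
  have h3 : (X ∘ Equiv.swap z j) z = X j := congrArg X (Equiv.swap_apply_left z j)
  have h4 : ∑ i, φ ((X ∘ Equiv.swap z j) i) = ∑ i, φ (X i) :=
    Equiv.sum_comp (Equiv.swap z j) fun i => φ (X i)
  rw [h3, h4]

end PooledFeatures

/-! ### The LP and LE layers -/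

/-- Power sums of sufficiently many projections, as an LP layer. -/
theorem pooledFeatures_lpLayer {N D K : ℕ} (hN : 1 ≤ N) (w : Fin K → Fin D ⊕ Fin D → ℝ) :
    PooledFeatures N w (fun x : Fin D → ℂ => lpLayer N w (reIm x)) := by
  have hsum : ∀ (X : Fin N → Fin D → ℂ) (k : Fin K) (s : Fin N),
      (∑ i, lpLayer N w (reIm (X i))) (finProdFinEquiv (k, s)) =
        ∑ i, (w k ⬝ᵥ reIm (X i)) ^ ((s : ℕ) + 1) := by
    intro X k s
    simp [lpLayer, powerMapping, Finset.sum_apply]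
  refine ⟨?_, fun C => ⟨max C 1, fun X hX i k => ?_⟩, fun X Y hXY k => ?_⟩
  · refine continuous_pi fun l => ?_
    exact (Continuous.dotProduct continuous_const continuous_reIm).pow _
  · have hb : ∀ s : Fin N, |∑ i, (w k ⬝ᵥ reIm (X i)) ^ ((s : ℕ) + 1)| ≤ C := fun s => by
      rw [← hsum]
      exact (norm_le_pi_norm _ _).trans hX
    -- For `N = 1` there is no second power, but the only feature is the projection itself.
    -- Otherwise the sum of squares bounds each projection.
    rcases hN.eq_or_lt with rfl | h2
    · have := hb 0
      rw [Fin.sum_univ_one] at this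
      rw [Subsingleton.elim i 0]
      exact le_max_of_le_left (by simpa using this)
    · have h3 := (le_abs_self _).trans (hb ⟨1, h2⟩)
      have h4 : (w k ⬝ᵥ reIm (X i)) ^ (1 + 1) ≤ ∑ i, (w k ⬝ᵥ reIm (X i)) ^ (1 + 1) :=
        Finset.single_le_sum (f := fun i => (w k ⬝ᵥ reIm (X i)) ^ (1 + 1))
          (fun j _ => by rw [one_add_one_eq_two]; positivity) (Finset.mem_univ i)
      refine abs_le_of_sq_le_sq ?_ (le_max_of_le_right zero_le_one)
      have h5 : (w k ⬝ᵥ reIm (X i)) ^ 2 ≤ C := h4.trans h3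
      nlinarith [le_max_left C 1, le_max_right C 1]
  · refine map_eq_of_powerSums_eq fun s => ?_
    rw [← hsum, ← hsum, hXY]

/-- The directions `s • ± w k`, `1 ≤ s ≤ N`. -/
def scaledDirections (N : ℕ) {D K : ℕ} (w : Fin K → Fin D ⊕ Fin D → ℝ) :
    Fin ((K + K) * N) → Fin D ⊕ Fin D → ℝ :=
  fun l => (((finProdFinEquiv.symm l).2 : ℕ) + 1 : ℝ) •
    Fin.append w (fun k => -w k) (finProdFinEquiv.symm l).1

/-- Exponentials along all multiples of the directions `± w k`, as an LE layer. -/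
theorem pooledFeatures_leLayer {N D K : ℕ} (hN : 1 ≤ N) (w : Fin K → Fin D ⊕ Fin D → ℝ) :
    PooledFeatures N w (fun x : Fin D → ℂ => leLayer (scaledDirections N w) (reIm x)) := by
  have hsum : ∀ (X : Fin N → Fin D → ℂ) (k : Fin (K + K)) (s : Fin N),
      (∑ i, leLayer (scaledDirections N w) (reIm (X i))) (finProdFinEquiv (k, s)) =
        ∑ i, Real.exp (Fin.append w (fun k => -w k) k ⬝ᵥ reIm (X i)) ^ ((s : ℕ) + 1) := by
    intro X k s
    simp [leLayer, scaledDirections, Finset.sum_apply, ← Real.exp_nat_mul]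
  refine ⟨?_, fun C => ⟨C, fun X hX i k => ?_⟩, fun X Y hXY k => ?_⟩
  · refine continuous_pi fun l => ?_
    exact Real.continuous_exp.comp (Continuous.dotProduct continuous_const continuous_reIm)
  -- From `t + 1 ≤ exp t`, a bounded exponential bounds `t` above only; the directions `-w k` supply
  -- the lower bound.
  · have hb : ∀ k', Fin.append w (fun k => -w k) k' ⬝ᵥ reIm (X i) ≤ C := fun k' => by
      have h1 := (le_abs_self _).trans ((norm_le_pi_norm _ (finProdFinEquiv (k', ⟨0, hN⟩))).trans hX)
      rw [hsum] at h1
      simp only [zero_add, pow_one] at h1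
      have h2 := Finset.single_le_sum
        (f := fun i => Real.exp (Fin.append w (fun k => -w k) k' ⬝ᵥ reIm (X i)))
        (fun j _ => (Real.exp_pos _).le) (Finset.mem_univ i)
      linarith [Real.add_one_le_exp (Fin.append w (fun k => -w k) k' ⬝ᵥ reIm (X i))]
    have h1 := hb (Fin.castAdd K k)
    have h2 := hb (Fin.natAdd K k)
    rw [Fin.append_left] at h1
    rw [Fin.append_right, neg_dotProduct] at h2
    exact abs_le.2 ⟨by linarith, h1⟩
  · have h1 : Finset.univ.val.map (fun i => Real.exp (w k ⬝ᵥ reIm (X i))) =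
        Finset.univ.val.map (fun i => Real.exp (w k ⬝ᵥ reIm (Y i))) := by
      refine map_eq_of_powerSums_eq fun s => ?_
      have hX := hsum X (Fin.castAdd K k) s
      have hY := hsum Y (Fin.castAdd K k) s
      rw [Fin.append_left] at hX hY
      rw [← hX, ← hY, hXY]
    refine Multiset.map_injective Real.exp_injective ?_
    simpa [Multiset.map_map, Function.comp_def] using h1

/-! ### Choice of sizes -/

theorem corollaryG1 (N D : ℕ) (hN : 1 ≤ N) (hD : 1 ≤ D) :
    (∀ f : Matrix (Fin N) (Fin D) ℂ → ℂ, Continuous f → IsPermInvariant f →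
      (∃ L : ℕ, 2 * N * (D + 1) ≤ L ∧ L ≤ 4 * N ^ 5 * D ^ 2 ∧
        ∃ (φ : (Fin D → ℂ) → (Fin L → ℝ)) (ρ : (Fin L → ℝ) → ℂ),
          Continuous φ ∧ Continuous ρ ∧ IsLP N φ ∧
          ∀ X : Matrix (Fin N) (Fin D) ℂ, f X = ρ (∑ i : Fin N, φ (X i))) ∧
      (∃ L : ℕ, 2 * N * D ≤ L ∧ L ≤ 4 * N ^ 4 * D ^ 2 ∧
        ∃ (φ : (Fin D → ℂ) → (Fin L → ℝ)) (ρ : (Fin L → ℝ) → ℂ),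
          Continuous φ ∧ Continuous ρ ∧ IsLE φ ∧
          ∀ X : Matrix (Fin N) (Fin D) ℂ, f X = ρ (∑ i : Fin N, φ (X i)))) ∧
    (∀ f : Matrix (Fin N) (Fin D) ℂ → (Fin N → ℂ), Continuous f → IsPermEquivariant f →
      (∃ L : ℕ, 2 * N * (D + 1) ≤ L ∧ L ≤ 4 * N ^ 5 * D ^ 2 ∧
        ∃ (φ : (Fin D → ℂ) → (Fin L → ℝ)) (ρ : (Fin D → ℂ) × (Fin L → ℝ) → ℂ),
          Continuous φ ∧ Continuous ρ ∧ IsLP N φ ∧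
          ∀ (X : Matrix (Fin N) (Fin D) ℂ) (j : Fin N),
            f X j = ρ (X j, ∑ i : Fin N, φ (X i))) ∧
      (∃ L : ℕ, 2 * N * D ≤ L ∧ L ≤ 4 * N ^ 4 * D ^ 2 ∧
        ∃ (φ : (Fin D → ℂ) → (Fin L → ℝ)) (ρ : (Fin D → ℂ) × (Fin L → ℝ) → ℂ),
          Continuous φ ∧ Continuous ρ ∧ IsLE φ ∧
          ∀ (X : Matrix (Fin N) (Fin D) ℂ) (j : Fin N),
            f X j = ρ (X j, ∑ i : Fin N, φ (X i)))) := by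
  -- The numbers of directions make both lengths `L` equal to their upper limits: `K * N` for LP, `2
  -- * K * N` for LE because of the two signs.
  obtain ⟨w, hw⟩ := exists_inGeneralPosition (Fin D ⊕ Fin D) (4 * N ^ 4 * D ^ 2)
  obtain ⟨u, hu⟩ := exists_inGeneralPosition (Fin D ⊕ Fin D) (2 * N ^ 3 * D ^ 2)
  have hφ := pooledFeatures_lpLayer hN w
  have hψ := pooledFeatures_leLayer hN u
  have hlp : IsLP N fun x : Fin D → ℂ => lpLayer N w (reIm x) := ⟨_, rfl, w, fun _ _ => rfl⟩
  have hle : IsLE fun x : Fin D → ℂ => leLayer (scaledDirections N u) (reIm x) :=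
    ⟨_, fun _ => rfl⟩
  have hND : N * D ≤ N ^ 3 * D ^ 2 :=
    Nat.mul_le_mul (Nat.le_self_pow (by norm_num) N) (Nat.le_self_pow (by norm_num) D)
  have hD1 : D ≤ N * D := Nat.le_mul_of_pos_left D hN
  have hND' : N ^ 3 * D ^ 2 ≤ N ^ 4 * D ^ 2 :=
    Nat.mul_le_mul_right _ (Nat.pow_le_pow_right hN (by norm_num))
  have hlt : N * (2 * D - 1) < 2 * (N * D) := by
    have h1 : N * (2 * D - 1) < N * (2 * D) := Nat.mul_lt_mul_of_pos_left (by omega) hN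
    have h2 : N * (2 * D) = 2 * (N * D) := by ring
    omega
  have hK : N * (2 * D - 1) < 4 * N ^ 4 * D ^ 2 := by
    rw [mul_assoc 4]; omega
  have hK' : 2 * D ≤ 4 * N ^ 4 * D ^ 2 := by
    rw [mul_assoc 4]; omega
  have hM : N * (2 * D - 1) < 2 * N ^ 3 * D ^ 2 := by
    rw [mul_assoc 2]; omega
  have hM' : 2 * D ≤ 2 * N ^ 3 * D ^ 2 := by
    rw [mul_assoc 2]; omega
  have hL1 : 2 * N * (D + 1) ≤ 4 * N ^ 4 * D ^ 2 * N := by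
    have h1 : 2 * (D + 1) ≤ 4 * N ^ 4 * D ^ 2 := by
      rw [mul_assoc 4]; omega
    calc 2 * N * (D + 1) = 2 * (D + 1) * N := by ring
      _ ≤ _ := Nat.mul_le_mul_right N h1
  have hL2 : 4 * N ^ 4 * D ^ 2 * N ≤ 4 * N ^ 5 * D ^ 2 := le_of_eq (by ring)
  have hM1 : 2 * N * D ≤ (2 * N ^ 3 * D ^ 2 + 2 * N ^ 3 * D ^ 2) * N := by
    have h1 : (2 * N ^ 3 * D ^ 2 + 2 * N ^ 3 * D ^ 2) * N = 4 * (N ^ 4 * D ^ 2) := by ring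
    rw [h1, mul_assoc 2]; omega
  have hM2 : (2 * N ^ 3 * D ^ 2 + 2 * N ^ 3 * D ^ 2) * N ≤ 4 * N ^ 4 * D ^ 2 :=
    le_of_eq (by ring)
  refine ⟨fun f hf hinv => ⟨?_, ?_⟩, fun f hf heq => ⟨?_, ?_⟩⟩
  · obtain ⟨ρ, hρ, h⟩ := hφ.exists_invariant hw hK hK' hf hinv
    exact ⟨_, hL1, hL2, _, ρ, hφ.continuous, hρ, hlp, h⟩
  · obtain ⟨ρ, hρ, h⟩ := hψ.exists_invariant hu hM hM' hf hinv
    exact ⟨_, hM1, hM2, _, ρ, hψ.continuous, hρ, hle, h⟩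
  · obtain ⟨ρ, hρ, h⟩ := hφ.exists_equivariant hw hN hK hK' hf heq
    exact ⟨_, hL1, hL2, _, ρ, hφ.continuous, hρ, hlp, h⟩
  · obtain ⟨ρ, hρ, h⟩ := hψ.exists_equivariant hu hN hM hM' hf heq
    exact ⟨_, hM1, hM2, _, ρ, hψ.continuous, hρ, hle, h⟩
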